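/- Let $\mathbb{C}^+=\{z\in\mathbb{C}:\operatorname{Re} z>0\}$ and let $\phi\in H^\infty(\mathbb{C}^+)$, that is, $\phi$ is a bounded analytic function on $\mathbb{C}^+$. Then for almost every $t\in\mathbb{R}$ the nontangential limit of $\phi$ at the boundary point $it$ exists; denote it by $\phi(it)$. The boundary function $t\mapsto\phi(it)$ belongs to $L^\infty(\mathbb{R})$, and \[\limsup_{\theta\to\infty}\,\sup_{y\in\mathbb{R}}\frac{1}{2\theta}\int_{y-\theta}^{y+\theta}\operatorname{Re}\phi(it)\,dt=\limsup_{x\to\infty}\,\sup_{y\in\mathbb{R}}\operatorname{Re}\phi(x+iy),\] \[\liminf_{\theta\to\infty}\,\inf_{y\in\mathbb{R}}\frac{1}{2\theta}\int_{y-\theta}^{y+\theta}\operatorname{Re}\phi(it)\,dt=\liminf_{x\to\infty}\,\inf_{y\in\mathbb{R}}\operatorname{Re}\phi(x+iy).\] Both equations also hold with $\operatorname{Re}$ replaced by $\operatorname{Im}$ on both sides. -/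

import Mathlib

open Filter Topology MeasureTheory

/-- The open right half plane `{z : ℂ | Re z > 0}`. -/
def rightHalfPlane : Set ℂ := {z : ℂ | 0 < z.re}

/-- `φ` is a bounded analytic function on the right half plane. The values of `φ` outside the
half plane play no role. -/
def IsHInfty (φ : ℂ → ℂ) : Prop :=
  DifferentiableOn ℂ φ rightHalfPlane ∧ ∃ C : ℝ, ∀ z ∈ rightHalfPlane, ‖φ z‖ ≤ C

/-- The sector of aperture `α` in the right half plane with vertex at the boundary point `i t`. -/
def stolzSector (α t : ℝ) : Set ℂ := {z : ℂ | 0 < z.re ∧ |z.im - t| ≤ α * z.re}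

/-- `φ` has the nontangential limit `L` at the boundary point `i t`: it tends to `L` inside every
sector with vertex at `i t`. -/
def HasNontangentialLimit (φ : ℂ → ℂ) (t : ℝ) (L : ℂ) : Prop :=
  ∀ α : ℝ, 0 < α → Tendsto φ (𝓝[stolzSector α t] ((t : ℂ) * Complex.I)) (𝓝 L)

open Classical in
/-- The boundary function `t ↦ φ (i t)`: the nontangential limit of `φ` at `i t` where it exists,
and `0` elsewhere. -/
noncomputable def boundaryFunction (φ : ℂ → ℂ) (t : ℝ) : ℂ :=
  if h : ∃ L : ℂ, HasNontangentialLimit φ t L then h.choose else 0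

/-- The average `(1 / 2θ) ∫_{y-θ}^{y+θ} u(t) dt`. -/
noncomputable def intervalMean (u : ℝ → ℝ) (θ y : ℝ) : ℝ :=
  1 / (2 * θ) * ∫ t in (y - θ)..(y + θ), u t

/-!
A bounded holomorphic `φ` is the derivative of a function `F` which is Lipschitz up to the
imaginary axis. By Rademacher's theorem `F` is differentiable along the axis at almost every
`i t`. At such a point let `G` be `F` minus its first-order expansion; for each `r > 0` the
Phragmén–Lindelöf principle bounds `G / (z - i t + r) ^ 2` by its values on the axis, and taking
`r = |z - i t|` turns the estimate `G = o(|z - i t|)` on the axis into the same estimate on the half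
plane. Cauchy's estimate in a sector then gives the nontangential limit of `φ = F'`.

The mean of the boundary function over `(y - θ, y + θ)` is the difference quotient of `F` across
that interval. Its real part is subject to a maximum principle (Phragmén–Lindelöf for
the exponential). Moving the difference quotient from the axis to the line `Re z = x` changes it by
`O(x / θ)`, while on that line `φ` oscillates by `O(θ / x)` over an interval of length `2θ`. Letting
one of `x`, `θ` tend to infinity before the other compares the upper limits in both directions.
-/

open Complex (I)
open scoped NNReal

variable {E : Type*} [NormedAddCommGroup E] [NormedSpace ℂ E]

section HalfPlane

theorem isOpen_rightHalfPlane : IsOpen rightHalfPlane :=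
  isOpen_lt continuous_const Complex.continuous_re

theorem add_mul_I_mem_rightHalfPlane_iff {z : ℂ} {t : ℝ} :
    z + t * I ∈ rightHalfPlane ↔ z ∈ rightHalfPlane := by
  simp [rightHalfPlane]

theorem ofReal_add_mul_I_mem_rightHalfPlane {x : ℝ} (hx : 0 < x) (y : ℝ) :
    (x : ℂ) + y * I ∈ rightHalfPlane :=
  add_mul_I_mem_rightHalfPlane_iff.2 <| by simpa [rightHalfPlane] using hx

theorem continuous_comp_vertical_line {X : Type*} [TopologicalSpace X] {f : ℂ → X}
    (hf : ContinuousOn f rightHalfPlane) {x : ℝ} (hx : 0 < x) :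
    Continuous fun s : ℝ => f (x + s * I) :=
  hf.comp_continuous (by fun_prop) (ofReal_add_mul_I_mem_rightHalfPlane hx)

theorem hasDerivAt_comp_vertical_line {f : ℂ → E} {f' : E} {x s : ℝ}
    (hf : HasDerivAt f f' (x + s * I)) :
    HasDerivAt (fun s : ℝ => f (x + s * I)) (I • f') s := by
  have hline : HasDerivAt (fun s : ℝ => (x : ℂ) + s * I) I s := by
    simpa using (Complex.ofRealCLM.hasDerivAt.mul_const I).const_add (x : ℂ)
  exact hf.scomp s hline

theorem mem_ball_ofReal_self_iff {r : ℝ} (hr : 0 ≤ r) {z : ℂ} :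
    z ∈ Metric.ball (r : ℂ) r ↔ Complex.normSq z < 2 * r * z.re := by
  rw [mem_ball_iff_norm, ← sq_lt_sq₀ (norm_nonneg _) hr, ← Complex.normSq_eq_norm_sq,
    Complex.normSq_sub, Complex.conj_ofReal, Complex.re_mul_ofReal, Complex.normSq_ofReal]
  constructor <;> intro h <;> linarith

theorem rightHalfPlane_eq_iUnion_ball :
    rightHalfPlane = ⋃ n : ℕ, Metric.ball ((n + 1 : ℝ) : ℂ) (n + 1) := by
  ext z
  simp only [Set.mem_iUnion, mem_ball_ofReal_self_iff (Nat.cast_add_one_pos _).le]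
  constructor
  · intro (hz : 0 < z.re)
    obtain ⟨n, hn⟩ := exists_nat_gt (Complex.normSq z / (2 * z.re))
    rw [div_lt_iff₀ (by positivity)] at hn
    exact ⟨n, by linarith⟩
  · rintro ⟨n, hn⟩
    exact pos_of_mul_pos_right ((Complex.normSq_nonneg z).trans_lt hn) (by positivity)

theorem monotone_ball_self : Monotone fun n : ℕ => Metric.ball ((n + 1 : ℝ) : ℂ) (n + 1) :=
  fun m n hmn => Metric.ball_subset_ball' <| by
    have h : (m : ℝ) ≤ n := by exact_mod_cast hmn
    rw [Complex.dist_of_im_eq (by simp), Complex.ofReal_re, Complex.ofReal_re, Real.dist_eq,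
      abs_of_nonpos (by linarith)]
    linarith

end HalfPlane

section Primitive

/-- Primitives on the members of the union, normalized at a common point, extend one another. -/
theorem isExactOn_iUnion_of_monotone {U : ℕ → Set ℂ} (hU : Monotone U) (hopen : ∀ n, IsOpen (U n))
    (hconn : ∀ n, IsPreconnected (U n)) {z₀ : ℂ} (hz₀ : z₀ ∈ U 0) {f : ℂ → E}
    (hf : ∀ n, Complex.IsExactOn f (U n)) : Complex.IsExactOn f (⋃ n, U n) := by
  choose g hg₀ hg using fun n => (hf n).with_val_at z₀ 0
  have hagree : ∀ {m n z}, z ∈ U m → z ∈ U n → g m z = g n z := by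
    suffices h : ∀ {m n}, m ≤ n → Set.EqOn (g m) (g n) (U m) from fun {m n z} hm hn =>
      (le_total m n).elim (fun hmn => h hmn hm) fun hnm => (h hnm hn).symm
    intro m n hmn
    refine (hopen m).eqOn_of_deriv_eq (hconn m)
      (fun z hz => (hg m z hz).differentiableAt.differentiableWithinAt)
      (fun z hz => (hg n z (hU hmn hz)).differentiableAt.differentiableWithinAt)
      (fun z hz => (hg m z hz).deriv.trans (hg n z (hU hmn hz)).deriv.symm)
      (hU m.zero_le hz₀) ((hg₀ m).trans (hg₀ n).symm)
  choose! k hk using fun z (hz : z ∈ ⋃ n, U n) => Set.mem_iUnion.1 hz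
  refine ⟨fun z => g (k z) z, fun z hz => (hg _ z (hk z hz)).congr_of_eventuallyEq ?_⟩
  filter_upwards [(hopen _).mem_nhds (hk z hz)] with w hw
  exact hagree (hk w (Set.mem_iUnion_of_mem _ hw)) hw

theorem isExactOn_rightHalfPlane [CompleteSpace E] {f : ℂ → E}
    (hf : DifferentiableOn ℂ f rightHalfPlane) : Complex.IsExactOn f rightHalfPlane := by
  rw [rightHalfPlane_eq_iUnion_ball] at hf ⊢
  exact isExactOn_iUnion_of_monotone monotone_ball_self (fun n => Metric.isOpen_ball)
    (fun n => (convex_ball _ _).isPreconnected) (z₀ := 1) (by simp)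
    fun n => (hf.mono (Set.subset_iUnion _ n)).isExactOn_ball

theorem IsHInfty.exists_lipschitzWith_primitive {φ : ℂ → ℂ} (hφ : IsHInfty φ) :
    ∃ (K : ℝ≥0) (F : ℂ → ℂ), LipschitzWith K F ∧ ∀ z ∈ rightHalfPlane, HasDerivAt F (φ z) z := by
  obtain ⟨hd, C, hC⟩ := hφ
  obtain ⟨F, hF⟩ := isExactOn_rightHalfPlane hd
  have hlip : LipschitzOnWith C.toNNReal F rightHalfPlane :=
    (convex_halfSpace_re_gt 0).lipschitzOnWith_of_nnnorm_hasDerivWithin_le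
      (fun z hz => (hF z hz).hasDerivWithinAt)
      fun z hz => NNReal.coe_le_coe.1 <| (hC z hz).trans (Real.le_coe_toNNReal C)
  obtain ⟨G, hG, hFG⟩ := hlip.extend_finite_dimension
  refine ⟨_, G, hG, fun z hz => (hF z hz).congr_of_eventuallyEq ?_⟩
  exact hFG.symm.eventuallyEq_of_mem (isOpen_rightHalfPlane.mem_nhds hz)

end Primitive

section CauchyEstimate

theorem closedBall_half_re_subset_rightHalfPlane {z : ℂ} (hz : z ∈ rightHalfPlane) :
    Metric.closedBall z (z.re / 2) ⊆ rightHalfPlane := by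
  intro v hv
  have hre : |(v - z).re| ≤ z.re / 2 :=
    (Complex.abs_re_le_norm _).trans (mem_closedBall_iff_norm.1 hv)
  rw [Complex.sub_re] at hre
  have hpos : 0 < z.re := hz
  change 0 < v.re
  linarith [neg_le_of_abs_le hre]

theorem norm_deriv_le_of_norm_le_closedBall {f : ℂ → E} (hd : DifferentiableOn ℂ f rightHalfPlane)
    {z : ℂ} (hz : z ∈ rightHalfPlane) {C : ℝ}
    (hC : ∀ v ∈ Metric.closedBall z (z.re / 2), ‖f v‖ ≤ C) : ‖deriv f z‖ ≤ 2 * C / z.re := by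
  have hcauchy := Complex.norm_deriv_le_of_forall_mem_sphere_norm_le (half_pos hz)
    (hd.diffContOnCl_ball (closedBall_half_re_subset_rightHalfPlane hz))
    fun v hv => hC v (Metric.sphere_subset_closedBall hv)
  rwa [div_div_eq_mul_div, mul_comm C] at hcauchy

theorem norm_sub_le_of_le_re {f : ℂ → E} (hd : DifferentiableOn ℂ f rightHalfPlane) {C : ℝ}
    (hC : ∀ z ∈ rightHalfPlane, ‖f z‖ ≤ C) {x : ℝ} (hx : 0 < x) {z w : ℂ} (hz : x ≤ z.re)
    (hw : x ≤ w.re) : ‖f z - f w‖ ≤ 2 * C / x * ‖z - w‖ := by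
  have hsub : {v : ℂ | x ≤ v.re} ⊆ rightHalfPlane := fun v hv => hx.trans_le hv
  have hC₀ : 0 ≤ C := (norm_nonneg _).trans (hC z (hsub hz))
  refine (convex_halfSpace_re_ge x).norm_image_sub_le_of_norm_deriv_le
    (fun v hv => hd.differentiableAt (isOpen_rightHalfPlane.mem_nhds (hsub hv)))
    (fun v (hv : x ≤ v.re) => ?_) hw hz
  refine (norm_deriv_le_of_norm_le_closedBall hd (hsub hv) fun u hu =>
    hC u (closedBall_half_re_subset_rightHalfPlane (hsub hv) hu)).trans ?_
  gcongr

end CauchyEstimate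

section AngularDerivative

theorem norm_le_of_norm_le_imaginary_axis {f : ℂ → E} {B M : ℝ}
    (hd : DiffContOnCl ℂ f rightHalfPlane) (hB : ∀ z ∈ rightHalfPlane, ‖f z‖ ≤ B)
    (hM : ∀ s : ℝ, ‖f (s * I)‖ ≤ M) {z : ℂ} (hz : 0 ≤ z.re) : ‖f z‖ ≤ M := by
  refine PhragmenLindelof.right_half_plane_of_bounded_on_real hd ⟨1, one_lt_two, 0, ?_⟩
    ⟨B, eventually_map.2 ?_⟩ hM hz
  · refine .of_bound B ?_
    filter_upwards [mem_inf_of_right (mem_principal_self _)] with w hw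
    simpa using hB w hw
  · filter_upwards [eventually_gt_atTop 0] with x hx
    simpa using hB _ (ofReal_add_mul_I_mem_rightHalfPlane hx 0)

theorem norm_sq_add_sq_le_norm_add_ofReal_sq {w : ℂ} (hw : 0 ≤ w.re) {r : ℝ} (hr : 0 ≤ r) :
    ‖w‖ ^ 2 + r ^ 2 ≤ ‖w + r‖ ^ 2 := by
  rw [← Complex.normSq_eq_norm_sq, ← Complex.normSq_eq_norm_sq, Complex.normSq_add,
    Complex.normSq_ofReal, Complex.conj_ofReal, Complex.re_mul_ofReal]
  linarith [mul_nonneg hw hr, sq r]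

theorem norm_mul_le_norm_add_ofReal_sq {w : ℂ} (hw : 0 ≤ w.re) {r : ℝ} (hr : 0 ≤ r) :
    ‖w‖ * r ≤ ‖w + r‖ ^ 2 := by
  nlinarith [norm_sq_add_sq_le_norm_add_ofReal_sq hw hr, two_mul_le_add_sq ‖w‖ r, norm_nonneg w]

/-- The Phragmén–Lindelöf principle for `G w / (w + r) ^ 2`. -/
theorem norm_le_mul_norm_add_ofReal_sq {G : ℂ → E} {K a b : ℝ≥0}
    (hd : DiffContOnCl ℂ G rightHalfPlane) (hK : ∀ z ∈ rightHalfPlane, ‖G z‖ ≤ K * ‖z‖)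
    (hab : ∀ s : ℝ, ‖G (s * I)‖ ≤ a * |s| + b * s ^ 2) {r : ℝ} (hr : 0 < r) {z : ℂ}
    (hz : z ∈ rightHalfPlane) : ‖G z‖ ≤ (a / r + b) * ‖z + r‖ ^ 2 := by
  have hden : ∀ {w : ℂ}, 0 ≤ w.re → 0 < ‖w + r‖ ^ 2 := fun hw =>
    (by positivity : (0 : ℝ) < _).trans_le (norm_sq_add_sq_le_norm_add_ofReal_sq hw hr.le)
  have hnorm : ∀ w : ℂ, ‖((w + r) ^ 2)⁻¹ • G w‖ = ‖G w‖ / ‖w + r‖ ^ 2 := fun w => by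
    rw [norm_smul, norm_inv, norm_pow, inv_mul_eq_div]
  have hdiff : DiffContOnCl ℂ (fun w : ℂ => ((w + r) ^ 2)⁻¹ • G w) rightHalfPlane := by
    refine DiffContOnCl.smul (.inv (Differentiable.diffContOnCl (by fun_prop)) fun w hw h => ?_) hd
    rw [rightHalfPlane, Complex.closure_setOfPred_lt_re] at hw
    exact (hden hw).ne' (by rw [← norm_pow, h, norm_zero])
  rw [← div_le_iff₀ (hden hz.le), ← hnorm]
  refine norm_le_of_norm_le_imaginary_axis (B := K / r) hdiff (fun w hw => ?_) (fun s => ?_) hz.le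
  · rw [hnorm, div_le_div_iff₀ (hden hw.le) hr]
    calc ‖G w‖ * r ≤ K * ‖w‖ * r := by gcongr; exact hK w hw
      _ = K * (‖w‖ * r) := mul_assoc ..
      _ ≤ K * ‖w + r‖ ^ 2 := by gcongr; exact norm_mul_le_norm_add_ofReal_sq hw.le hr.le
  · have hre : 0 ≤ ((s : ℂ) * I).re := by simp
    have hsq : |s| ≤ ‖s * I + r‖ := by simpa using Complex.abs_im_le_norm (s * I + r)
    have hlin : |s| * r ≤ ‖s * I + r‖ ^ 2 := by
      simpa using norm_mul_le_norm_add_ofReal_sq hre hr.le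
    rw [hnorm, div_le_iff₀ (hden hre)]
    calc ‖G (s * I)‖ ≤ a * |s| + b * |s| ^ 2 := by simpa using hab s
      _ = a / r * (|s| * r) + b * |s| ^ 2 := by field_simp
      _ ≤ a / r * ‖s * I + r‖ ^ 2 + b * ‖s * I + r‖ ^ 2 := by
        gcongr
      _ = (a / r + b) * ‖s * I + r‖ ^ 2 := by ring

theorem norm_le_of_norm_le_linear_add_quadratic_imaginary_axis {G : ℂ → E} {K a b : ℝ≥0}
    (hd : DiffContOnCl ℂ G rightHalfPlane) (hK : ∀ z ∈ rightHalfPlane, ‖G z‖ ≤ K * ‖z‖)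
    (hab : ∀ s : ℝ, ‖G (s * I)‖ ≤ a * |s| + b * s ^ 2) {z : ℂ} (hz : z ∈ rightHalfPlane) :
    ‖G z‖ ≤ 4 * (a * ‖z‖ + b * ‖z‖ ^ 2) := by
  have hz₀ : 0 < ‖z‖ := norm_pos_iff.2 fun h => (show 0 < z.re from hz).ne' (by simp [h])
  have htwo : ‖z + (‖z‖ : ℝ)‖ ≤ 2 * ‖z‖ := (norm_add_le _ _).trans_eq (by simp [two_mul])
  calc ‖G z‖ ≤ (a / ‖z‖ + b) * ‖z + (‖z‖ : ℝ)‖ ^ 2 :=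
        norm_le_mul_norm_add_ofReal_sq hd hK hab hz₀ hz
    _ ≤ (a / ‖z‖ + b) * (2 * ‖z‖) ^ 2 := by gcongr
    _ = 4 * (a * ‖z‖ + b * ‖z‖ ^ 2) := by field_simp; ring

theorem exists_norm_le_linear_add_quadratic_of_isLittleO {F : Type*} [SeminormedAddCommGroup F]
    {g : ℝ → F} {K : ℝ≥0} (hK : ∀ s, ‖g s‖ ≤ K * |s|) (hg : g =o[𝓝 0] fun s => s) {a : ℝ≥0}
    (ha : 0 < a) : ∃ b : ℝ≥0, ∀ s, ‖g s‖ ≤ a * |s| + b * s ^ 2 := by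
  obtain ⟨δ, hδ₀, hδ⟩ := Metric.eventually_nhds_iff.1 (Asymptotics.isLittleO_iff.1 hg ha)
  lift δ to ℝ≥0 using hδ₀.le
  refine ⟨K / δ, fun s => ?_⟩
  push_cast
  rcases lt_or_ge |s| δ with hs | hs
  · calc ‖g s‖ ≤ a * |s| := hδ (by simpa using hs)
      _ ≤ a * |s| + K / δ * s ^ 2 := le_add_of_nonneg_right (by positivity)
  · calc ‖g s‖ ≤ K * |s| := hK s
      _ = K / δ * (δ * |s|) := by field_simp
      _ ≤ K / δ * (|s| * |s|) := by gcongr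
      _ = K / δ * s ^ 2 := by rw [abs_mul_abs_self, sq]
      _ ≤ a * |s| + K / δ * s ^ 2 := le_add_of_nonneg_left (by positivity)

theorem isLittleO_of_isLittleO_imaginary_axis {G : ℂ → E} {K : ℝ≥0}
    (hd : DiffContOnCl ℂ G rightHalfPlane) (hK : ∀ z, ‖G z‖ ≤ K * ‖z‖)
    (hG : (fun s : ℝ => G (s * I)) =o[𝓝 0] fun s => s) :
    G =o[𝓝[rightHalfPlane] 0] fun z => z := by
  refine Asymptotics.isLittleO_iff.2 fun c hc => ?_
  lift c to ℝ≥0 using hc.le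
  have hc₈ : 0 < c / 8 := div_pos (NNReal.coe_pos.1 hc) (by norm_num)
  obtain ⟨b, hb⟩ := exists_norm_le_linear_add_quadratic_of_isLittleO
    (fun s => by simpa using hK (s * I)) hG hc₈
  have hsmall : ∀ᶠ z : ℂ in 𝓝 0, b * ‖z‖ < c / 8 :=
    (Continuous.tendsto' (by fun_prop) 0 0 (by simp)).eventually_lt_const (by exact_mod_cast hc₈)
  filter_upwards [hsmall.filter_mono nhdsWithin_le_nhds, self_mem_nhdsWithin] with z hbz hz
  calc ‖G z‖ ≤ 4 * ((c / 8 : ℝ≥0) * ‖z‖ + b * ‖z‖ ^ 2) :=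
        norm_le_of_norm_le_linear_add_quadratic_imaginary_axis hd (fun w _ => hK w) hb hz
    _ = 4 * (c / 8 + b * ‖z‖) * ‖z‖ := by push_cast; ring
    _ ≤ 4 * (c / 8 + c / 8) * ‖z‖ := by gcongr
    _ = c * ‖z‖ := by ring

theorem hasDerivWithinAt_of_hasDerivAt_imaginary_axis {F : ℂ → E} {K : ℝ≥0}
    (hK : LipschitzWith K F) (hd : DifferentiableOn ℂ F rightHalfPlane) {t : ℝ} {L : E}
    (hL : HasDerivAt (fun s : ℝ => F (s * I)) (I • L) t) :
    HasDerivWithinAt F L rightHalfPlane (t * I) := by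
  set G : ℂ → E := fun w => F (w + t * I) - F (t * I) - w • L with hG
  have hGd : DifferentiableOn ℂ G rightHalfPlane := by
    refine ((hd.comp (by fun_prop) fun w hw => ?_).sub_const _).sub (by fun_prop)
    exact add_mul_I_mem_rightHalfPlane_iff.2 hw
  have hGc : Continuous G := by have := hK.continuous; fun_prop
  have hGK : ∀ w, ‖G w‖ ≤ (K + ‖L‖₊ : ℝ≥0) * ‖w‖ := fun w => by
    calc ‖G w‖ ≤ ‖F (w + t * I) - F (t * I)‖ + ‖w • L‖ := norm_sub_le _ _
      _ ≤ K * ‖w‖ + ‖w‖ * ‖L‖ := by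
        gcongr
        · simpa [dist_eq_norm] using hK.dist_le_mul (w + t * I) (t * I)
        · exact norm_smul_le w L
      _ = (K + ‖L‖₊ : ℝ≥0) * ‖w‖ := by push_cast; ring
  have hGo : (fun s : ℝ => G (s * I)) =o[𝓝 0] fun s => s :=
    (hasDerivAt_iff_isLittleO_nhds_zero.1 hL).congr_left fun s => by
      simp only [hG, Complex.ofReal_add, add_mul, add_comm ((t : ℂ) * I), smul_smul,
        RCLike.real_smul_eq_coe_smul (K := ℂ), Complex.coe_algebraMap]
  have htrans : Tendsto (fun z : ℂ => z - t * I) (𝓝[rightHalfPlane] (t * I))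
      (𝓝[rightHalfPlane] 0) := by
    refine tendsto_nhdsWithin_iff.2 ⟨?_, ?_⟩
    · have hcont : Continuous fun z : ℂ => z - t * I := by fun_prop
      exact (hcont.tendsto' _ _ (sub_self _)).mono_left nhdsWithin_le_nhds
    · filter_upwards [self_mem_nhdsWithin] with z hz
      rwa [← add_mul_I_mem_rightHalfPlane_iff (t := t), sub_add_cancel]
  rw [hasDerivWithinAt_iff_isLittleO]
  refine ((isLittleO_of_isLittleO_imaginary_axis ⟨hGd, hGc.continuousOn⟩ hGK hGo).comp_tendsto
    htrans).congr_left fun z => ?_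
  simp only [hG, Function.comp_apply, sub_add_cancel]

theorem norm_sub_le_of_mem_stolzSector {α t : ℝ} {z : ℂ} (hz : z ∈ stolzSector α t) :
    ‖z - t * I‖ ≤ (1 + α) * z.re := by
  calc ‖z - t * I‖ ≤ |(z - t * I).re| + |(z - t * I).im| := Complex.norm_le_abs_re_add_abs_im _
    _ = z.re + |z.im - t| := by simp [abs_of_pos hz.1]
    _ ≤ z.re + α * z.re := by gcongr; exact hz.2
    _ = (1 + α) * z.re := by ring

theorem stolzSector_subset_rightHalfPlane (α t : ℝ) : stolzSector α t ⊆ rightHalfPlane :=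
  fun _ hz => hz.1

/-- Cauchy's estimate on discs of radius `Re z / 2`, which is comparable to `‖z - it‖` in the
sector. -/
theorem tendsto_deriv_zero_of_isLittleO {G : ℂ → E} (hd : DifferentiableOn ℂ G rightHalfPlane)
    {t : ℝ} (hG : G =o[𝓝[rightHalfPlane] (t * I)] fun z => z - t * I) {α : ℝ} (hα : 0 < α) :
    Tendsto (deriv G) (𝓝[stolzSector α t] (t * I)) (𝓝 0) := by
  rw [← Asymptotics.isLittleO_one_iff ℝ, Asymptotics.isLittleO_iff]
  intro ε hε
  have hc : 0 < ε / (4 * (1 + α)) := by positivity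
  obtain ⟨δ, hδ₀, hδ⟩ := Metric.eventually_nhds_iff.1
    (eventually_nhdsWithin_iff.1 (Asymptotics.isLittleO_iff.1 hG hc))
  filter_upwards [self_mem_nhdsWithin, nhdsWithin_le_nhds (Metric.ball_mem_nhds _ (half_pos hδ₀))]
    with z hz hzδ
  rw [mem_ball_iff_norm] at hzδ
  have hx : 0 < z.re := hz.1
  have hxz : z.re ≤ ‖z - t * I‖ := by simpa using Complex.re_le_norm (z - t * I)
  have hbound : ∀ v ∈ Metric.closedBall z (z.re / 2),
      ‖G v‖ ≤ ε / (4 * (1 + α)) * (2 * ((1 + α) * z.re)) := fun v hv => by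
    have hvt : ‖v - t * I‖ ≤ z.re / 2 + ‖z - t * I‖ :=
      (norm_sub_le_norm_sub_add_norm_sub v z _).trans
        (by gcongr; exact mem_closedBall_iff_norm.1 hv)
    refine (hδ ((dist_eq_norm _ _).trans_lt (by linarith))
      (closedBall_half_re_subset_rightHalfPlane hx hv)).trans ?_
    gcongr
    linarith [norm_sub_le_of_mem_stolzSector hz]
  refine (norm_deriv_le_of_norm_le_closedBall hd hx hbound).trans_eq ?_
  rw [norm_one]
  field_simp
  ring

theorem tendsto_deriv_of_hasDerivWithinAt {F : ℂ → E} (hd : DifferentiableOn ℂ F rightHalfPlane)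
    {t : ℝ} {L : E} (hL : HasDerivWithinAt F L rightHalfPlane (t * I)) {α : ℝ} (hα : 0 < α) :
    Tendsto (deriv F) (𝓝[stolzSector α t] (t * I)) (𝓝 L) := by
  have hG : DifferentiableOn ℂ (fun z => F z - F (t * I) - (z - t * I) • L) rightHalfPlane :=
    (hd.sub_const _).sub (by fun_prop)
  have hlim := tendsto_deriv_zero_of_isLittleO hG (hasDerivWithinAt_iff_isLittleO.1 hL) hα
  refine tendsto_sub_nhds_zero_iff.1 (hlim.congr' ?_)
  filter_upwards [self_mem_nhdsWithin] with z hz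
  have hF := (hd.differentiableAt (isOpen_rightHalfPlane.mem_nhds
    (stolzSector_subset_rightHalfPlane α t hz))).hasDerivAt
  have hline : HasDerivAt (fun w : ℂ => (w - t * I) • L) L z := by
    simpa using ((hasDerivAt_id z).sub_const (t * I)).smul_const L
  exact ((hF.sub_const (F (t * I))).fun_sub hline).deriv

end AngularDerivative

section NontangentialLimit

variable {φ F : ℂ → ℂ} {K : ℝ≥0}

theorem hasNontangentialLimit_of_hasDerivAt_imaginary_axis (hK : LipschitzWith K F)
    (hF : ∀ z ∈ rightHalfPlane, HasDerivAt F (φ z) z) {t : ℝ} {L : ℂ}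
    (hL : HasDerivAt (fun s : ℝ => F (s * I)) (I • L) t) : HasNontangentialLimit φ t L := by
  have hd : DifferentiableOn ℂ F rightHalfPlane := fun z hz =>
    (hF z hz).differentiableAt.differentiableWithinAt
  intro α hα
  refine (tendsto_deriv_of_hasDerivWithinAt hd
    (hasDerivWithinAt_of_hasDerivAt_imaginary_axis hK hd hL) hα).congr' ?_
  filter_upwards [self_mem_nhdsWithin] with z hz
  exact (hF z (stolzSector_subset_rightHalfPlane α t hz)).deriv

theorem IsHInfty.ae_exists_hasNontangentialLimit (hφ : IsHInfty φ) :
    ∀ᵐ t : ℝ, ∃ L, HasNontangentialLimit φ t L := by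
  obtain ⟨K, F, hK, hF⟩ := hφ.exists_lipschitzWith_primitive
  have hline : LipschitzWith 1 fun s : ℝ => (s : ℂ) * I :=
    LipschitzWith.of_dist_le_mul fun s t => by simp [dist_eq_norm, ← sub_mul, ← Complex.ofReal_sub]
  filter_upwards [(hK.comp hline).ae_differentiableAt_real] with t ht
  refine ⟨-I * deriv (F ∘ fun s : ℝ => (s : ℂ) * I) t,
    hasNontangentialLimit_of_hasDerivAt_imaginary_axis hK hF ?_⟩
  rw [smul_eq_mul, ← mul_assoc, mul_neg, Complex.I_mul_I, neg_neg, one_mul]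
  exact ht.hasDerivAt

theorem IsHInfty.ae_hasNontangentialLimit_boundaryFunction (hφ : IsHInfty φ) :
    ∀ᵐ t : ℝ, HasNontangentialLimit φ t (boundaryFunction φ t) := by
  filter_upwards [hφ.ae_exists_hasNontangentialLimit] with t ht
  rw [boundaryFunction, dif_pos ht]
  exact ht.choose_spec

theorem HasNontangentialLimit.tendsto_radial {t : ℝ} {L : ℂ} (h : HasNontangentialLimit φ t L) :
    Tendsto (fun x : ℝ => φ (x + t * I)) (𝓝[>] 0) (𝓝 L) := by
  refine (h 1 one_pos).comp (tendsto_nhdsWithin_iff.2 ⟨?_, ?_⟩)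
  · exact (Continuous.tendsto' (by fun_prop) 0 _ (by simp)).mono_left nhdsWithin_le_nhds
  · filter_upwards [self_mem_nhdsWithin] with x (hx : 0 < x)
    simpa [stolzSector] using ⟨hx, hx.le⟩

theorem HasNontangentialLimit.const_mul {t : ℝ} {L : ℂ} (h : HasNontangentialLimit φ t L) (c : ℂ) :
    HasNontangentialLimit (fun z => c * φ z) t (c * L) :=
  fun α hα => (h α hα).const_mul c

theorem IsHInfty.const_mul (hφ : IsHInfty φ) (c : ℂ) : IsHInfty fun z => c * φ z := by
  obtain ⟨hd, C, hC⟩ := hφ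
  refine ⟨hd.const_mul c, ‖c‖ * C, fun z hz => ?_⟩
  rw [norm_mul]
  gcongr
  exact hC z hz

end NontangentialLimit

section BoundaryValues

variable {φ : ℂ → ℂ} {b : ℝ → ℂ}

theorem aestronglyMeasurable_of_hasNontangentialLimit (hφ : ContinuousOn φ rightHalfPlane)
    (hb : ∀ᵐ t : ℝ, HasNontangentialLimit φ t (b t)) : AEStronglyMeasurable b := by
  obtain ⟨u, -, hu₀, hu⟩ := exists_seq_strictAnti_tendsto (0 : ℝ)
  refine aestronglyMeasurable_of_tendsto_ae atTop (f := fun n (t : ℝ) => φ (u n + t * I))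
    (fun n => (continuous_comp_vertical_line hφ (hu₀ n)).aestronglyMeasurable) ?_
  filter_upwards [hb] with t ht
  exact ht.tendsto_radial.comp (tendsto_nhdsWithin_iff.2 ⟨hu, .of_forall hu₀⟩)

theorem HasNontangentialLimit.norm_le {t : ℝ} {L : ℂ} (h : HasNontangentialLimit φ t L) {C : ℝ}
    (hC : ∀ z ∈ rightHalfPlane, ‖φ z‖ ≤ C) : ‖L‖ ≤ C := by
  refine le_of_tendsto h.tendsto_radial.norm ?_
  filter_upwards [self_mem_nhdsWithin] with x hx
  exact hC _ (ofReal_add_mul_I_mem_rightHalfPlane hx t)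

theorem IsHInfty.memLp_top_of_hasNontangentialLimit (hφ : IsHInfty φ)
    (hb : ∀ᵐ t : ℝ, HasNontangentialLimit φ t (b t)) : MemLp b ⊤ := by
  obtain ⟨hd, C, hC⟩ := hφ
  exact memLp_top_of_bound (aestronglyMeasurable_of_hasNontangentialLimit hd.continuousOn hb) C
    (hb.mono fun t ht => ht.norm_le hC)

theorem IsHInfty.intervalIntegrable_of_hasNontangentialLimit (hφ : IsHInfty φ)
    (hb : ∀ᵐ t : ℝ, HasNontangentialLimit φ t (b t)) (a c : ℝ) :
    IntervalIntegrable b volume a c :=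
  (((hφ.memLp_top_of_hasNontangentialLimit hb).locallyIntegrable le_top).integrableOn_isCompact
    isCompact_uIcc).intervalIntegrable

theorem IsHInfty.integral_eq_sub_of_hasNontangentialLimit (hφ : IsHInfty φ)
    (hb : ∀ᵐ t : ℝ, HasNontangentialLimit φ t (b t)) {F : ℂ → ℂ} (hFc : Continuous F)
    (hF : ∀ z ∈ rightHalfPlane, HasDerivAt F (φ z) z) (a c : ℝ) :
    I * ∫ t in a..c, b t = F (c * I) - F (a * I) := by
  obtain ⟨hd, C, hC⟩ := hφ
  have hline : ∀ {x : ℝ}, 0 < x → Continuous fun s : ℝ => φ (x + s * I) := fun hx =>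
    continuous_comp_vertical_line hd.continuousOn hx
  have hleft : Tendsto (fun x : ℝ => I * ∫ t in a..c, φ (x + t * I)) (𝓝[>] 0)
      (𝓝 (I * ∫ t in a..c, b t)) := by
    refine (intervalIntegral.tendsto_integral_filter_of_dominated_convergence (fun _ => C)
      ?_ ?_ intervalIntegrable_const ?_).const_mul I
    · filter_upwards [self_mem_nhdsWithin] with x hx
      exact (hline hx).aestronglyMeasurable
    · filter_upwards [self_mem_nhdsWithin] with x hx
      exact .of_forall fun t _ => hC _ (ofReal_add_mul_I_mem_rightHalfPlane hx t)
    · filter_upwards [hb] with t ht _ using ht.tendsto_radial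
  have hright : Tendsto (fun x : ℝ => F (x + c * I) - F (x + a * I)) (𝓝[>] 0)
      (𝓝 (F (c * I) - F (a * I))) :=
    (Continuous.tendsto' (by fun_prop) 0 _ (by simp)).mono_left nhdsWithin_le_nhds
  refine tendsto_nhds_unique hleft (hright.congr' ?_)
  filter_upwards [self_mem_nhdsWithin] with x hx
  rw [← intervalIntegral.integral_const_mul]
  exact (intervalIntegral.integral_eq_sub_of_hasDerivAt
    (fun s _ => hasDerivAt_comp_vertical_line (hF _ (ofReal_add_mul_I_mem_rightHalfPlane hx s)))
    (((hline hx).const_mul I).intervalIntegrable _ _)).symm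

end BoundaryValues

/-- The symmetric difference quotient of `F` at `z` in the vertical direction, with half-step `θ`.
For a primitive `F` of `φ`, its values at the points `i y` are the means of the boundary function
of `φ` over `(y - θ, y + θ)`. -/
noncomputable def verticalSlope (F : ℂ → ℂ) (θ : ℝ) (z : ℂ) : ℂ :=
  slope F (z - θ * I) (z + θ * I)

section VerticalSlope

variable {φ F : ℂ → ℂ} {K : ℝ≥0} {C M x θ : ℝ}

theorem verticalSlope_eq_div (F : ℂ → ℂ) (θ : ℝ) (z : ℂ) :
    verticalSlope F θ z = -I * (F (z + θ * I) - F (z - θ * I)) / (2 * θ : ℝ) := by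
  rw [verticalSlope, slope_def_field, show z + θ * I - (z - θ * I) = (2 * θ : ℝ) * I by
    push_cast; ring, div_mul_eq_div_div_swap, Complex.div_I, neg_mul, mul_comm I]

theorem verticalSlope_re (F : ℂ → ℂ) (θ x y : ℝ) :
    (verticalSlope F θ (x + y * I)).re =
      ((-I * F (x + (y + θ : ℝ) * I)).re - (-I * F (x + (y - θ : ℝ) * I)).re) / (2 * θ) := by
  rw [verticalSlope_eq_div, Complex.div_ofReal_re, mul_sub, Complex.sub_re]
  push_cast
  simp only [add_mul, sub_mul, add_assoc, add_sub_assoc]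

theorem norm_verticalSlope_le (hK : LipschitzWith K F) (hθ : 0 < θ) (z : ℂ) :
    ‖verticalSlope F θ z‖ ≤ K := by
  have hF := hK.norm_sub_le (z + θ * I) (z - θ * I)
  rw [verticalSlope_eq_div, norm_div, norm_mul, norm_neg, Complex.norm_I, one_mul,
    Complex.norm_of_nonneg (by positivity), div_le_iff₀ (by positivity)]
  refine hF.trans_eq ?_
  rw [show z + θ * I - (z - θ * I) = (2 * θ : ℝ) * I by push_cast; ring, norm_mul, Complex.norm_I,
    mul_one, Complex.norm_of_nonneg (by positivity)]

theorem norm_verticalSlope_sub_le (hK : LipschitzWith K F) (hθ : 0 < θ) (z w : ℂ) :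
    ‖verticalSlope F θ z - verticalSlope F θ w‖ ≤ K * ‖z - w‖ / θ := by
  have hadd := hK.norm_sub_le (z + θ * I) (w + θ * I)
  have hsub := hK.norm_sub_le (z - θ * I) (w - θ * I)
  rw [add_sub_add_right_eq_sub] at hadd
  rw [sub_sub_sub_cancel_right] at hsub
  rw [verticalSlope_eq_div, verticalSlope_eq_div, ← sub_div, ← mul_sub, sub_sub_sub_comm, norm_div,
    norm_mul, norm_neg, Complex.norm_I, one_mul, Complex.norm_of_nonneg (by positivity)]
  calc ‖(F (z + θ * I) - F (w + θ * I)) - (F (z - θ * I) - F (w - θ * I))‖ / (2 * θ)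
      ≤ (K * ‖z - w‖ + K * ‖z - w‖) / (2 * θ) := by
        gcongr
        exact (norm_sub_le _ _).trans (add_le_add hadd hsub)
    _ = K * ‖z - w‖ / θ := by field_simp; ring

theorem exists_verticalSlope_re_eq (hF : ∀ z ∈ rightHalfPlane, HasDerivAt F (φ z) z)
    (hθ : 0 < θ) (hx : 0 < x) (y : ℝ) :
    ∃ ξ ∈ Set.Ioo (y - θ) (y + θ), (verticalSlope F θ (x + y * I)).re = (φ (x + ξ * I)).re := by
  have hd : ∀ s : ℝ, HasDerivAt (fun s : ℝ => (-I * F (x + s * I)).re) (φ (x + s * I)).re s := by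
    intro s
    have h := (hasDerivAt_comp_vertical_line
      (hF _ (ofReal_add_mul_I_mem_rightHalfPlane hx s))).const_mul (-I)
    rw [smul_eq_mul, ← mul_assoc, neg_mul, Complex.I_mul_I, neg_neg, one_mul] at h
    exact Complex.reCLM.hasFDerivAt.comp_hasDerivAt s h
  obtain ⟨ξ, hξ, h⟩ := exists_hasDerivAt_eq_slope _ _ (show y - θ < y + θ by linarith)
    (fun s _ => (hd s).continuousAt.continuousWithinAt) (fun s _ => hd s)
  refine ⟨ξ, hξ, ?_⟩
  rw [h, verticalSlope_re, show y + θ - (y - θ) = 2 * θ by ring]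

theorem verticalSlope_re_le (hK : LipschitzWith K F) (hd : DifferentiableOn ℂ F rightHalfPlane)
    (hθ : 0 < θ) (hM : ∀ y : ℝ, (verticalSlope F θ (y * I)).re ≤ M) {z : ℂ}
    (hz : z ∈ rightHalfPlane) : (verticalSlope F θ z).re ≤ M := by
  have hshift : ∀ s : ℝ, DifferentiableOn ℂ (fun w => F (w + s * I)) rightHalfPlane := fun s =>
    hd.comp (by fun_prop) fun w hw => add_mul_I_mem_rightHalfPlane_iff.2 hw
  have hdiff : DifferentiableOn ℂ (verticalSlope F θ) rightHalfPlane := by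
    have h := (((hshift θ).fun_sub (hshift (-θ))).const_mul (-I)).div_const ((2 * θ : ℝ) : ℂ)
    simpa only [funext (verticalSlope_eq_div F θ), Complex.ofReal_neg, neg_mul, ← sub_eq_add_neg]
      using h
  have hcont : Continuous (verticalSlope F θ) := by
    have hFc := hK.continuous
    simp only [funext (verticalSlope_eq_div F θ)]
    fun_prop
  have hnorm : ‖Complex.exp (verticalSlope F θ z)‖ ≤ Real.exp M := by
    refine norm_le_of_norm_le_imaginary_axis (f := fun w => Complex.exp (verticalSlope F θ w))
      (B := Real.exp K) ⟨hdiff.cexp, (Complex.continuous_exp.comp hcont).continuousOn⟩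
      (fun w _ => ?_) (fun s => ?_) hz.le <;>
    rw [Complex.norm_exp, Real.exp_le_exp]
    · exact (Complex.re_le_norm _).trans (norm_verticalSlope_le hK hθ w)
    · exact hM s
  rwa [Complex.norm_exp, Real.exp_le_exp] at hnorm

theorem verticalSlope_re_le_add (hK : LipschitzWith K F)
    (hF : ∀ z ∈ rightHalfPlane, HasDerivAt F (φ z) z) (hθ : 0 < θ) (hx : 0 < x)
    (hM : ∀ y : ℝ, (φ (x + y * I)).re ≤ M) (y : ℝ) :
    (verticalSlope F θ (y * I)).re ≤ M + K * x / θ := by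
  obtain ⟨ξ, -, hξ⟩ := exists_verticalSlope_re_eq hF hθ hx y
  have hsub := (Complex.re_le_norm _).trans
    (norm_verticalSlope_sub_le hK hθ (y * I) (x + y * I))
  rw [sub_add_cancel_right, norm_neg, Complex.norm_of_nonneg hx.le, Complex.sub_re] at hsub
  linarith [hM ξ]

theorem re_le_add_of_verticalSlope_re_le (hC : ∀ z ∈ rightHalfPlane, ‖φ z‖ ≤ C)
    (hφ : DifferentiableOn ℂ φ rightHalfPlane) (hK : LipschitzWith K F)
    (hF : ∀ z ∈ rightHalfPlane, HasDerivAt F (φ z) z) (hθ : 0 < θ) (hx : 0 < x)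
    (hM : ∀ y : ℝ, (verticalSlope F θ (y * I)).re ≤ M) (y : ℝ) :
    (φ (x + y * I)).re ≤ M + 2 * C * θ / x := by
  have hd : DifferentiableOn ℂ F rightHalfPlane := fun z hz =>
    (hF z hz).differentiableAt.differentiableWithinAt
  have hmem := ofReal_add_mul_I_mem_rightHalfPlane hx y
  have hC₀ : 0 ≤ C := (norm_nonneg _).trans (hC _ hmem)
  obtain ⟨ξ, hξmem, hξ⟩ := exists_verticalSlope_re_eq hF hθ hx y
  have hdist : ‖(x + y * I : ℂ) - (x + ξ * I)‖ ≤ θ := by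
    rw [add_sub_add_left_eq_sub, ← sub_mul, norm_mul, Complex.norm_I, mul_one,
      ← Complex.ofReal_sub, Complex.norm_real, Real.norm_eq_abs, abs_le]
    constructor <;> linarith [hξmem.1, hξmem.2]
  have hosc : (φ (x + y * I)).re - (φ (x + ξ * I)).re ≤ 2 * C * θ / x :=
    calc (φ (x + y * I)).re - (φ (x + ξ * I)).re ≤ ‖φ (x + y * I) - φ (x + ξ * I)‖ := by
          simpa only [Complex.sub_re] using Complex.re_le_norm (φ (x + y * I) - φ (x + ξ * I))
      _ ≤ 2 * C / x * ‖(x + y * I : ℂ) - (x + ξ * I)‖ :=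
          norm_sub_le_of_le_re hφ hC hx (by simp) (by simp)
      _ ≤ 2 * C / x * θ := by gcongr
      _ = 2 * C * θ / x := by ring
  linarith [verticalSlope_re_le hK hd hθ hM hmem]

theorem IsHInfty.intervalMean_re_eq {b : ℝ → ℂ} (hφ : IsHInfty φ)
    (hb : ∀ᵐ t : ℝ, HasNontangentialLimit φ t (b t)) (hFc : Continuous F)
    (hF : ∀ z ∈ rightHalfPlane, HasDerivAt F (φ z) z) (θ y : ℝ) :
    intervalMean (fun t => (b t).re) θ y = (verticalSlope F θ (y * I)).re := by
  have hre : ∫ t in (y - θ)..(y + θ), (b t).re = (∫ t in (y - θ)..(y + θ), b t).re :=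
    Complex.reCLM.intervalIntegral_comp_comm
      (hφ.intervalIntegrable_of_hasNontangentialLimit hb (y - θ) (y + θ))
  rw [intervalMean, hre, one_div_mul_eq_div, verticalSlope_eq_div, ← add_mul, ← sub_mul,
    ← Complex.ofReal_add, ← Complex.ofReal_sub,
    ← hφ.integral_eq_sub_of_hasNontangentialLimit hb hFc hF, ← mul_assoc, neg_mul,
    Complex.I_mul_I, neg_neg, one_mul, Complex.div_ofReal_re]

end VerticalSlope

section ExtendedReals

variable {ι κ : Type*}

theorem limsup_iSup_coe_le_liminf_iSup_coe {u : ℝ → ι → ℝ} {v : ℝ → κ → ℝ} {c : ℝ → ℝ}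
    (h : ∀ x > 0, ∀ θ > 0, ∀ M, (∀ j, v x j ≤ M) → ∀ i, u θ i ≤ M + c x / θ) :
    limsup (fun θ => ⨆ i, (u θ i : EReal)) atTop ≤
      liminf (fun x => ⨆ j, (v x j : EReal)) atTop := by
  refine le_liminf_of_le (by isBoundedDefault) ?_
  filter_upwards [eventually_gt_atTop 0] with x hx
  refine EReal.le_of_forall_lt_iff_le.1 fun M hM => ?_
  have hvM : ∀ j, v x j ≤ M := fun j => EReal.coe_le_coe_iff.1 ((le_iSup _ j).trans hM.le)
  have hlim : Tendsto (fun θ : ℝ => ((M + c x / θ : ℝ) : EReal)) atTop (𝓝 M) := by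
    refine (continuous_coe_real_ereal.tendsto M).comp ?_
    simpa using (tendsto_id.const_div_atTop (c x)).const_add M
  rw [← hlim.limsup_eq]
  refine limsup_le_limsup ?_
  filter_upwards [eventually_gt_atTop 0] with θ hθ
  exact iSup_le fun i => EReal.coe_le_coe_iff.2 (h x hx θ hθ M hvM i)

theorem liminf_iInf_coe_eq_neg_limsup_iSup_coe_neg (l : Filter κ) (u : κ → ι → ℝ) :
    liminf (fun x => ⨅ i, (u x i : EReal)) l =
      -limsup (fun x => ⨆ i, ((-u x i : ℝ) : EReal)) l := by
  rw [← EReal.liminf_neg]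
  congr with x
  rw [Pi.neg_apply, eq_comm, neg_eq_iff_eq_neg]
  exact (EReal.negOrderIso.map_iInf fun i => (u x i : EReal)).symm

end ExtendedReals

section Comparison

variable {φ : ℂ → ℂ} {b : ℝ → ℂ}

theorem IsHInfty.limsup_iSup_intervalMean_re (hφ : IsHInfty φ)
    (hb : ∀ᵐ t : ℝ, HasNontangentialLimit φ t (b t)) :
    limsup (fun θ : ℝ => ⨆ y : ℝ, ((intervalMean (fun t => (b t).re) θ y : ℝ) : EReal)) atTop
      = limsup (fun x : ℝ => ⨆ y : ℝ, (((φ (x + y * I)).re : ℝ) : EReal)) atTop := by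
  obtain ⟨K, F, hK, hF⟩ := hφ.exists_lipschitzWith_primitive
  simp only [hφ.intervalMean_re_eq hb hK.continuous hF]
  obtain ⟨hd, C, hC⟩ := hφ
  refine le_antisymm
    ((limsup_iSup_coe_le_liminf_iSup_coe (c := fun x => K * x) ?_).trans liminf_le_limsup)
    ((limsup_iSup_coe_le_liminf_iSup_coe (c := fun θ => 2 * C * θ) ?_).trans liminf_le_limsup)
  · exact fun x hx θ hθ M hM => verticalSlope_re_le_add hK hF hθ hx hM
  · exact fun θ hθ x hx M hM => re_le_add_of_verticalSlope_re_le hC hd hK hF hθ hx hM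

theorem IsHInfty.liminf_iInf_intervalMean_re (hφ : IsHInfty φ)
    (hb : ∀ᵐ t : ℝ, HasNontangentialLimit φ t (b t)) :
    liminf (fun θ : ℝ => ⨅ y : ℝ, ((intervalMean (fun t => (b t).re) θ y : ℝ) : EReal)) atTop
      = liminf (fun x : ℝ => ⨅ y : ℝ, (((φ (x + y * I)).re : ℝ) : EReal)) atTop := by
  have h := (hφ.const_mul (-1)).limsup_iSup_intervalMean_re (hb.mono fun t ht => ht.const_mul (-1))
  rw [liminf_iInf_coe_eq_neg_limsup_iSup_coe_neg, liminf_iInf_coe_eq_neg_limsup_iSup_coe_neg]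
  congr 1
  simpa [intervalMean] using h

end Comparison

/-- The upper and lower limits, suprema and infima are taken in `EReal`, where they always exist.
The first two conjuncts say that the boundary function is a genuine nontangential limit almost
everywhere and is an element of `L^∞(ℝ)`. -/
theorem theorem4p1 (φ : ℂ → ℂ) (hφ : IsHInfty φ) :
    (∀ᵐ t : ℝ, HasNontangentialLimit φ t (boundaryFunction φ t)) ∧
    MemLp (boundaryFunction φ) ⊤ (volume : Measure ℝ) ∧
    limsup (fun θ : ℝ => ⨆ y : ℝ,
        ((intervalMean (fun t => (boundaryFunction φ t).re) θ y : ℝ) : EReal)) atTop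
      = limsup (fun x : ℝ => ⨆ y : ℝ, (((φ (x + y * Complex.I)).re : ℝ) : EReal)) atTop ∧
    liminf (fun θ : ℝ => ⨅ y : ℝ,
        ((intervalMean (fun t => (boundaryFunction φ t).re) θ y : ℝ) : EReal)) atTop
      = liminf (fun x : ℝ => ⨅ y : ℝ, (((φ (x + y * Complex.I)).re : ℝ) : EReal)) atTop ∧
    limsup (fun θ : ℝ => ⨆ y : ℝ,
        ((intervalMean (fun t => (boundaryFunction φ t).im) θ y : ℝ) : EReal)) atTop
      = limsup (fun x : ℝ => ⨆ y : ℝ, (((φ (x + y * Complex.I)).im : ℝ) : EReal)) atTop ∧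
    liminf (fun θ : ℝ => ⨅ y : ℝ,
        ((intervalMean (fun t => (boundaryFunction φ t).im) θ y : ℝ) : EReal)) atTop
      = liminf (fun x : ℝ => ⨅ y : ℝ, (((φ (x + y * Complex.I)).im : ℝ) : EReal)) atTop := by
  have hb := hφ.ae_hasNontangentialLimit_boundaryFunction
  have hφ' : IsHInfty fun z => -I * φ z := hφ.const_mul (-I)
  have hb' : ∀ᵐ t : ℝ, HasNontangentialLimit (fun z => -I * φ z) t (-I * boundaryFunction φ t) :=
    hb.mono fun t ht => ht.const_mul (-I)
  refine ⟨hb, hφ.memLp_top_of_hasNontangentialLimit hb, hφ.limsup_iSup_intervalMean_re hb,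
    hφ.liminf_iInf_intervalMean_re hb, ?_, ?_⟩
  · simpa using hφ'.limsup_iSup_intervalMean_re hb'
  · simpa using hφ'.liminf_iInf_intervalMean_re hb'
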